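/- **Theorem (Identifiability).** Let $d\ge 2$ and let $\langle x,y\rangle_L=-x_0y_0+\sum_{j=1}^d x_jy_j$ on $\mathbb{R}^{d+1}$. Let $\mathbb{H}^d=\{x\in\mathbb{R}^{d+1}:\langle x,x\rangle_L=-1,\ x_0>0\}$ be hyperbolic space in the Lorentz model, with tangent spaces $T_x\mathbb{H}^d=\{v:\langle x,v\rangle_L=0\}$, the Riemannian metric and volume measure $\mathrm{vol}$ induced by $\langle\cdot,\cdot\rangle_L$, and origin $o=(1,0,\dots,0)$, where $T_o\mathbb{H}^d$ is identified with $\mathbb{R}^d$ by $(0,v)\leftrightarrow v$. Let $\operatorname{Exp}_\mu(v)=\cosh(\|v\|)\,\mu+\sinh(\|v\|)\,v/\|v\|$ (with $\operatorname{Exp}_\mu(0)=\mu$) be the exponential map, $\operatorname{Log}_\mu$ its inverse, and $PT_{o\to\mu}(v)=v+\frac{\langle \mu,v\rangle_L}{1-\langle o,\mu\rangle_L}(o+\mu)$ parallel transport along the geodesic from $o$ to $\mu$. Put $\mathsf{T}_\mu(x)=PT_{o\to\mu}^{-1}(\operatorname{Log}_\mu(x))\in\mathbb{R}^d$. For $\mu\in\mathbb{H}^d$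 and $\Sigma$ in the set $\mathcal{S}^{++}(d)$ of real symmetric positive definite $d\times d$ matrices, let $\mathrm{HWN}_d(\mu,\Sigma)$ be the law of $\operatorname{Exp}_\mu(PT_{o\to\mu}Z)$ with $Z\sim N_d(0,\Sigma)$. 1. The family $\{\mathrm{HWN}_d(\mu,\Sigma):(\mu,\Sigma)\in\mathbb{H}^d\times\mathcal{S}^{++}(d)\}$ is identifiable: for all $\mu,\mu'\in\mathbb{H}^d$ and $\Sigma,\Sigma'\in\mathcal{S}^{++}(d)$, if $\mathrm{HWN}_d(\mu,\Sigma)=\mathrm{HWN}_d(\mu',\Sigma')$, then $\mu=\mu'$ and $\Sigma=\Sigma'$. 2. For all $\mu\in\mathbb{H}^d$ and $\Sigma\in\mathcal{S}^{++}(d)$, the law $\mathrm{HWN}_d(\mu,\Sigma)$ has with respect to $\mathrm{vol}$ the density $$p_{\mu,\Sigma}(x)=(2\pi)^{-d/2}(\det\Sigma)^{-1/2}\exp\Bigl(-\tfrac12\mathsf{T}_\mu(x)^\top\Sigma^{-1}\mathsf{T}_\mu(x)\Bigr)\Bigl(\frac{\|\mathsf{T}_\mu(x)\|}{\sinh\|\mathsf{T}_\mu(x)\|}\Bigr)^{d-1},$$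 with the last factor read as $1$ at $x=\mu$. This density is continuous on $\mathbb{H}^d$, and $\mu$ is its unique mode: $p_{\mu,\Sigma}(x)<p_{\mu,\Sigma}(\mu)$ for every $x\ne\mu$. 3. For all $\mu\in\mathbb{H}^d$ and $\Sigma\in\mathcal{S}^{++}(d)$, if $X\sim\mathrm{HWN}_d(\mu,\Sigma)$, then $\mathsf{T}_\mu(X)\sim N_d(0,\Sigma)$. -/

import Mathlib

namespace HWN

open MeasureTheory ProbabilityTheory

noncomputable section

/-- The Lorentz bilinear form on `ℝ^(d+1)`: `-x₀ y₀ + ∑ⱼ xⱼ yⱼ`. -/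
def lor {d : ℕ} (x y : Fin (d + 1) → ℝ) : ℝ :=
  -(x 0 * y 0) + ∑ j : Fin d, x j.succ * y j.succ

/-- Hyperbolic space in the Lorentz model, with the topology and the Borel sigma-algebra
induced from `ℝ^(d+1)`. -/
abbrev Hyp (d : ℕ) : Type := {x : Fin (d + 1) → ℝ // lor x x = -1 ∧ 0 < x 0}

lemma lor_comm {d : ℕ} (x y : Fin (d + 1) → ℝ) : lor x y = lor y x := by
  simp [lor, mul_comm]

lemma lor_add_right {d : ℕ} (x y z : Fin (d + 1) → ℝ) :
    lor x (y + z) = lor x y + lor x z := by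
  simp only [lor, Pi.add_apply, mul_add, Finset.sum_add_distrib]; ring

lemma lor_smul_right {d : ℕ} (c : ℝ) (x y : Fin (d + 1) → ℝ) :
    lor x (c • y) = c * lor x y := by
  simp only [lor, Pi.smul_apply, smul_eq_mul, mul_add, Finset.mul_sum]
  congr 1
  · ring
  · exact Finset.sum_congr rfl fun _ _ => by ring

lemma lor_add_left {d : ℕ} (x y z : Fin (d + 1) → ℝ) :
    lor (x + y) z = lor x z + lor y z := by
  rw [lor_comm, lor_add_right, lor_comm z x, lor_comm z y]

lemma lor_smul_left {d : ℕ} (c : ℝ) (x y : Fin (d + 1) → ℝ) :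
    lor (c • x) y = c * lor x y := by
  rw [lor_comm, lor_smul_right, lor_comm y x]

/-- The tangent space at `x`: the Lorentz orthogonal complement of `x`. -/
def Tangent {d : ℕ} (x : Hyp d) : Submodule ℝ (Fin (d + 1) → ℝ) where
  carrier := {v | lor x.1 v = 0}
  add_mem' {v w} hv hw := by
    have hv' : lor x.1 v = 0 := hv
    have hw' : lor x.1 w = 0 := hw
    show lor x.1 (v + w) = 0
    rw [lor_add_right, hv', hw', add_zero]
  zero_mem' := by simp [lor]
  smul_mem' c v hv := by
    have hv' : lor x.1 v = 0 := hv
    show lor x.1 (c • v) = 0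
    rw [lor_smul_right, hv', mul_zero]

lemma lor_tangent {d : ℕ} {x : Hyp d} (v : Tangent x) : lor x.1 v.1 = 0 := v.2

/-- The Riemannian norm of a tangent vector. -/
def tnorm {d : ℕ} {x : Hyp d} (v : Tangent x) : ℝ := √(lor v.1 v.1)

lemma cauchy {d : ℕ} (x y : Fin (d + 1) → ℝ) :
    (lor x y + x 0 * y 0) ^ 2 ≤ (lor x x + x 0 ^ 2) * (lor y y + y 0 ^ 2) := by
  have h := Finset.sum_mul_sq_le_sq_mul_sq Finset.univ
    (fun j : Fin d => x j.succ) (fun j : Fin d => y j.succ)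
  have e1 : ∀ z w : Fin (d + 1) → ℝ,
      lor z w + z 0 * w 0 = ∑ j : Fin d, z j.succ * w j.succ := fun z w => by
    simp only [lor]; ring
  rw [e1, pow_two (x 0), pow_two (y 0), e1, e1]
  simpa only [pow_two] using h

lemma sq_le_of_tangent {d : ℕ} {x : Hyp d} (v : Tangent x) :
    v.1 0 ^ 2 ≤ (x.1 0 ^ 2 - 1) * lor v.1 v.1 := by
  have h := cauchy x.1 v.1
  rw [lor_tangent v, x.2.1] at h
  nlinarith

lemma one_le_sq {d : ℕ} (x : Hyp d) : 1 ≤ x.1 0 ^ 2 := by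
  have h : (0 : ℝ) ≤ lor x.1 x.1 + x.1 0 ^ 2 := by
    have : lor x.1 x.1 + x.1 0 ^ 2 = ∑ j : Fin d, x.1 j.succ * x.1 j.succ := by
      simp only [lor]; ring
    rw [this]
    exact Finset.sum_nonneg fun j _ => mul_self_nonneg _
  rw [x.2.1] at h
  linarith

/-- The restriction of the Lorentz form to a tangent space is nonnegative. -/
lemma lor_self_nonneg {d : ℕ} {x : Hyp d} (v : Tangent x) : 0 ≤ lor v.1 v.1 := by
  by_contra! hneg
  have h1 := sq_le_of_tangent v
  have h2 := one_le_sq x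
  have h3 : lor v.1 v.1 + v.1 0 ^ 2 = ∑ j : Fin d, v.1 j.succ * v.1 j.succ := by
    simp only [lor]; ring
  have h4 : 0 ≤ lor v.1 v.1 + v.1 0 ^ 2 := by
    rw [h3]; exact Finset.sum_nonneg fun j _ => mul_self_nonneg _
  nlinarith

lemma tnorm_sq {d : ℕ} {x : Hyp d} (v : Tangent x) : tnorm v ^ 2 = lor v.1 v.1 :=
  Real.sq_sqrt (lor_self_nonneg v)

/-- The reversed Cauchy-Schwarz inequality. -/
lemma one_le_neg_lor {d : ℕ} (x y : Hyp d) : 1 ≤ -lor x.1 y.1 := by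
  have h := cauchy x.1 y.1
  rw [x.2.1, y.2.1] at h
  have hx := one_le_sq x
  have hy := one_le_sq y
  have hp := mul_pos x.2.2 y.2.2
  have h5 : (x.1 0 * y.1 0) ^ 2 ≥ 1 := by rw [mul_pow]; nlinarith
  by_contra! hlt
  nlinarith [sq_nonneg (x.1 0 - y.1 0), sq_nonneg (lor x.1 y.1 + 1)]

/-- The exponential map `cosh(‖v‖) x + sinh(‖v‖) v / ‖v‖`, with value `x` at `v = 0`. -/
def expMap {d : ℕ} (x : Hyp d) (v : Tangent x) : Hyp d :=
  ⟨Real.cosh (tnorm v) • x.1 + (Real.sinh (tnorm v) / tnorm v) • v.1, by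
    have hr := tnorm_sq v
    have h0 : 0 ≤ tnorm v := Real.sqrt_nonneg _
    have hs := sq_le_of_tangent v
    have hcs := Real.cosh_sq (tnorm v)
    constructor
    · rw [lor_add_left, lor_add_right, lor_add_right]
      simp only [lor_smul_left, lor_smul_right]
      rw [lor_comm v.1 x.1, lor_tangent v, x.2.1, ← hr]
      rcases h0.eq_or_lt with h | h
      · simp [← h]
      · field_simp
        linear_combination (-tnorm v) * hcs
    · simp only [Pi.add_apply, Pi.smul_apply, smul_eq_mul]
      have hx := x.2.2
      rcases h0.eq_or_lt with h | h
      · simp [← h, hx]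
      · have hab : |v.1 0| ≤ x.1 0 * tnorm v := by
          apply abs_le_of_sq_le_sq _ (by positivity)
          rw [mul_pow, hr]
          nlinarith [lor_self_nonneg v]
        have hlow : -(x.1 0 * tnorm v) ≤ v.1 0 := (abs_le.mp hab).1
        have hsinh : 0 < Real.sinh (tnorm v) := Real.sinh_pos_iff.mpr h
        have hlt : Real.sinh (tnorm v) < Real.cosh (tnorm v) := Real.sinh_lt_cosh _
        have h1 : Real.sinh (tnorm v) / tnorm v * -(x.1 0 * tnorm v)
            ≤ Real.sinh (tnorm v) / tnorm v * v.1 0 :=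
          mul_le_mul_of_nonneg_left hlow (by positivity)
        have h2 : Real.sinh (tnorm v) / tnorm v * -(x.1 0 * tnorm v)
            = -(Real.sinh (tnorm v) * x.1 0) := by field_simp
        nlinarith⟩

/-- The hyperbolic distance. -/
def rho {d : ℕ} (x y : Hyp d) : ℝ := Real.arcosh (-lor x.1 y.1)

/-- The logarithm map; at `y = x` the vector `y + ⟨x, y⟩ x` vanishes, so the value is `0`. -/
def logMap {d : ℕ} (x y : Hyp d) : Tangent x :=
  ⟨(rho x y / √((-lor x.1 y.1) ^ 2 - 1)) • (y.1 + lor x.1 y.1 • x.1), by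
    show lor x.1 _ = 0
    rw [lor_smul_right, lor_add_right, lor_smul_right, x.2.1]
    ring⟩

lemma transport_mem {d : ℕ} (x y : Hyp d) (v : Tangent x) :
    lor y.1 (v.1 + (lor y.1 v.1 / (1 - lor x.1 y.1)) • (x.1 + y.1)) = 0 := by
  have h := one_le_neg_lor x y
  have hne : 1 - lor x.1 y.1 ≠ 0 := by linarith
  rw [lor_add_right, lor_smul_right, lor_add_right, y.2.1, lor_comm y.1 x.1]
  field_simp
  ring

lemma transport_inv {d : ℕ} (x y : Hyp d) (v : Tangent x) :
    (v.1 + (lor y.1 v.1 / (1 - lor x.1 y.1)) • (x.1 + y.1))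
      + (lor x.1 (v.1 + (lor y.1 v.1 / (1 - lor x.1 y.1)) • (x.1 + y.1))
        / (1 - lor y.1 x.1)) • (y.1 + x.1) = v.1 := by
  have h := one_le_neg_lor x y
  have hne : 1 - lor x.1 y.1 ≠ 0 := by linarith
  rw [lor_add_right, lor_smul_right, lor_add_right, x.2.1, lor_tangent v, lor_comm y.1 x.1]
  ext i
  simp only [Pi.add_apply, Pi.smul_apply, smul_eq_mul]
  field_simp
  ring

/-- Parallel transport from `x` to `y` along the unique geodesic, in the Lorentz model:
`v ↦ v + ⟨y, v⟩ / (1 - ⟨x, y⟩) (x + y)`; its inverse is the transport from `y` to `x`.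
See `transport_parallel` for the parallelism along geodesics. -/
def transport {d : ℕ} (x y : Hyp d) : Tangent x ≃ₗ[ℝ] Tangent y where
  toFun v := ⟨v.1 + (lor y.1 v.1 / (1 - lor x.1 y.1)) • (x.1 + y.1), transport_mem x y v⟩
  invFun w := ⟨w.1 + (lor x.1 w.1 / (1 - lor y.1 x.1)) • (y.1 + x.1), transport_mem y x w⟩
  map_add' v w := by
    apply Subtype.ext
    simp only [Submodule.coe_add, lor_add_right, add_div, add_smul]
    abel
  map_smul' c v := by
    apply Subtype.ext
    simp only [Submodule.coe_smul, lor_smul_right, RingHom.id_apply, smul_add, smul_smul,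
      mul_div_assoc]
  left_inv v := Subtype.ext (transport_inv x y v)
  right_inv w := Subtype.ext (transport_inv y x w)

lemma expMap_smul_coe {d : ℕ} (x : Hyp d) (u : Tangent x) (t : ℝ) :
    (expMap x (t • u)).1 = Real.cosh (t * tnorm u) • x.1
      + (Real.sinh (t * tnorm u) / tnorm u) • u.1 := by
  have hn : tnorm (t • u) = |t| * tnorm u := by
    simp only [tnorm, Submodule.coe_smul, lor_smul_left, lor_smul_right]
    rw [← mul_assoc, Real.sqrt_mul (mul_self_nonneg t), Real.sqrt_mul_self_eq_abs]
  have h0 : 0 ≤ tnorm u := Real.sqrt_nonneg _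
  simp only [expMap, hn, Submodule.coe_smul, smul_smul]
  rcases le_total 0 t with ht | ht
  · rw [abs_of_nonneg ht]
    rcases eq_or_ne t 0 with rfl | h
    · simp
    · congr 2
      field_simp
  · rw [abs_of_nonpos ht]
    rcases eq_or_ne t 0 with rfl | h
    · simp
    · rw [neg_mul, Real.cosh_neg, Real.sinh_neg]
      congr 2
      field_simp

lemma eq_zero_of_tnorm {d : ℕ} {x : Hyp d} (u : Tangent x) (h : tnorm u = 0) : u.1 = 0 := by
  have h1 : lor u.1 u.1 = 0 := by rw [← tnorm_sq u, h]; ring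
  have h2 := sq_le_of_tangent u
  rw [h1, mul_zero] at h2
  have h3 : u.1 0 = 0 := by nlinarith
  have h4 : ∑ j : Fin d, u.1 j.succ * u.1 j.succ = 0 := by
    simpa [lor, h3] using h1
  rw [Finset.sum_eq_zero_iff_of_nonneg fun j _ => mul_self_nonneg _] at h4
  funext i
  refine Fin.cases h3 (fun j => ?_) i
  exact mul_self_eq_zero.mp (h4 j (Finset.mem_univ j))

/-- `transport` is the Levi-Civita parallel transport: along every geodesic
`γ(t) = expMap x (t • u)` the derivative of the transported vector is normal to the tangent
space (a multiple of `γ(t)`), so that the field has covariant derivative zero. -/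
lemma transport_parallel {d : ℕ} (x : Hyp d) (u v : Tangent x) (t : ℝ) :
    HasDerivAt (fun s : ℝ => (transport x (expMap x (s • u)) v).1)
      (lor u.1 v.1 • (expMap x (t • u)).1) t := by
  rcases eq_or_ne (tnorm u) 0 with h | h
  · have hu : u = 0 := Subtype.ext (eq_zero_of_tnorm u h)
    subst hu
    have hz : lor (0 : Fin (d + 1) → ℝ) v.1 = 0 := by simp [lor]
    have hf : (fun s : ℝ => (transport x (expMap x (s • (0 : Tangent x))) v).1)
        = fun _ => (transport x (expMap x 0) v).1 := funext fun s =>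
      congrArg (fun w : Tangent x => (transport x (expMap x w) v).1) (smul_zero s)
    rw [hf, Submodule.coe_zero, hz, zero_smul]
    exact hasDerivAt_const t _
  · have hform : ∀ s : ℝ, (transport x (expMap x (s • u)) v).1
        = v.1 + lor u.1 v.1 • ((Real.sinh (s * tnorm u) / tnorm u) • x.1
          + ((Real.cosh (s * tnorm u) - 1) / tnorm u ^ 2) • u.1) := by
      intro s
      show v.1 + (lor (expMap x (s • u)).1 v.1 / (1 - lor x.1 (expMap x (s • u)).1))
        • (x.1 + (expMap x (s • u)).1) = _
      rw [expMap_smul_coe]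
      simp only [lor_add_left, lor_add_right, lor_smul_left, lor_smul_right, lor_tangent,
        x.2.1]
      have hc : 1 + Real.cosh (s * tnorm u) ≠ 0 := by
        have := Real.cosh_pos (s * tnorm u); linarith
      have hcs := Real.cosh_sq (s * tnorm u)
      generalize Real.cosh (s * tnorm u) = c at *
      generalize Real.sinh (s * tnorm u) = e at *
      have hc' : 1 - (c * -1 + e / tnorm u * 0) ≠ 0 := by
        intro h0; apply hc; linarith
      ext i
      simp only [Pi.add_apply, Pi.smul_apply, smul_eq_mul]
      have he : e ^ 2 = (c - 1) * (1 + c) := by linear_combination -hcs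
      have h1 : 1 - (c * -1 + e / tnorm u * 0) = 1 + c := by ring
      rw [h1]
      field_simp
      linear_combination (lor u.1 v.1 * u.1 i) * he
    simp only [hform, expMap_smul_coe]
    have hl : HasDerivAt (fun s : ℝ => s * tnorm u) (tnorm u) t := by
      simpa using (hasDerivAt_id t).mul_const (tnorm u)
    have h1 := (hl.sinh.div_const (tnorm u)).smul_const x.1
    have h2 := ((hl.cosh.sub_const 1).div_const (tnorm u ^ 2)).smul_const u.1
    have h3 := ((h1.add h2).const_smul (lor u.1 v.1)).const_add v.1
    have e1 : Real.cosh (t * tnorm u) * tnorm u / tnorm u = Real.cosh (t * tnorm u) := by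
      field_simp
    have e2 : Real.sinh (t * tnorm u) * tnorm u / tnorm u ^ 2
        = Real.sinh (t * tnorm u) / tnorm u := by
      field_simp
    rw [e1, e2] at h3
    exact h3

/-- The origin `o = (1, 0, …, 0)`. -/
def origin (d : ℕ) : Hyp d := ⟨Fin.cons 1 0, by simp [lor], by simp⟩

/-- The identification `v ↔ (0, v)` of `ℝ^d` with the tangent space at the origin. -/
def originIso (d : ℕ) : EuclideanSpace ℝ (Fin d) ≃ₗ[ℝ] Tangent (origin d) where
  toFun v := ⟨Fin.cons 0 v.ofLp, by show lor _ _ = 0; simp [lor, origin]⟩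
  invFun w := WithLp.toLp 2 (Fin.tail w.1)
  map_add' v w := by
    apply Subtype.ext
    funext i
    refine Fin.cases ?_ (fun j => ?_) i <;> simp
  map_smul' c v := by
    apply Subtype.ext
    funext i
    refine Fin.cases ?_ (fun j => ?_) i <;> simp
  left_inv v := by ext i; simp [Fin.tail]
  right_inv w := by
    apply Subtype.ext
    have h0 : w.1 0 = 0 := by
      have := lor_tangent w
      simpa [lor, origin] using this
    funext i
    refine Fin.cases ?_ (fun j => ?_) i
    · simp [h0]
    · simp [Fin.tail]

/-- The wrapping map `z ↦ Exp_μ (PT_{o → μ} z)`. -/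
def wrap {d : ℕ} (μ : Hyp d) (z : EuclideanSpace ℝ (Fin d)) : Hyp d :=
  expMap μ (transport (origin d) μ (originIso d z))

/-- The tangent coordinates `T_μ(x) = PT_{o → μ}⁻¹ (Log_μ x)`. -/
def tangentCoord {d : ℕ} (μ x : Hyp d) : EuclideanSpace ℝ (Fin d) :=
  (originIso d).symm ((transport (origin d) μ).symm (logMap μ x))

/-- The wrapping map is measurable, so that the push-forward below is a genuine one. -/
lemma measurable_wrap {d : ℕ} (μ : Hyp d) : Measurable (wrap μ) := by
  let L : EuclideanSpace ℝ (Fin d) →ₗ[ℝ] (Fin (d + 1) → ℝ) :=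
    (Tangent μ).subtype ∘ₗ (transport (origin d) μ).toLinearMap ∘ₗ (originIso d).toLinearMap
  have hL : Measurable fun z => L z := L.continuous_of_finiteDimensional.measurable
  have hi : ∀ i, Measurable fun z => L z i := fun i => (measurable_pi_apply i).comp hL
  have hn : Measurable fun z => √(lor (L z) (L z)) := by
    refine Measurable.sqrt (((hi 0).mul (hi 0)).neg.add ?_)
    exact Finset.measurable_sum _ fun j _ => (hi j.succ).mul (hi j.succ)
  have key : Measurable fun z => Real.cosh √(lor (L z) (L z)) • μ.1
      + (Real.sinh √(lor (L z) (L z)) / √(lor (L z) (L z))) • L z :=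
    ((Real.measurable_cosh.comp hn).smul_const μ.1).add
      (((Real.measurable_sinh.comp hn).div hn).smul hL)
  exact key.subtype_mk

/-- The anisotropic hyperbolic wrapped normal distribution: the law of
`Exp_μ (PT_{o → μ} Z)` for `Z ∼ N(0, S)`. -/
def hwn {d : ℕ} (μ : Hyp d) (S : Matrix (Fin d) (Fin d) ℝ) : Measure (Hyp d) :=
  (multivariateGaussian 0 S).map (wrap μ)

/-- The global parametrization `u ↦ (√(1 + ‖u‖²), u)` of the hyperboloid by `ℝ^d`. -/
def graphVec {d : ℕ} (u : EuclideanSpace ℝ (Fin d)) : Fin (d + 1) → ℝ :=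
  Fin.cons √(1 + ‖u‖ ^ 2) u.ofLp

/-- The same parametrization as a map into `Hyp d`. -/
def graphMap {d : ℕ} (u : EuclideanSpace ℝ (Fin d)) : Hyp d :=
  ⟨graphVec u, by
    constructor
    · have h : (0 : ℝ) ≤ 1 + ‖u‖ ^ 2 := by positivity
      simp only [lor, graphVec, Fin.cons_zero, Fin.cons_succ]
      rw [Real.mul_self_sqrt h, EuclideanSpace.real_norm_sq_eq]
      simp only [← pow_two]
      ring
    · simp only [graphVec, Fin.cons_zero]
      positivity⟩

/-- The matrix of the Riemannian metric in this parametrization: the Lorentz products of the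
coordinate tangent vectors. -/
def metricMatrix {d : ℕ} (u : EuclideanSpace ℝ (Fin d)) : Matrix (Fin d) (Fin d) ℝ :=
  Matrix.of fun i j =>
    lor (fderiv ℝ graphVec u (EuclideanSpace.single i 1))
      (fderiv ℝ graphVec u (EuclideanSpace.single j 1))

/-- The Riemannian volume measure of hyperbolic space: `√(det g(u)) du` in the global
parametrization. -/
def hypVolume (d : ℕ) : Measure (Hyp d) :=
  ((volume : Measure (EuclideanSpace ℝ (Fin d))).withDensity
    fun u => ENNReal.ofReal √(metricMatrix u).det).map graphMap

open Classical in
/-- The density of the hyperbolic wrapped normal distribution, with `r = ‖T_μ(x)‖` and the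
last factor read as `1` at `x = μ`. -/
def hwnDensity {d : ℕ} (μ : Hyp d) (S : Matrix (Fin d) (Fin d) ℝ) (x : Hyp d) : ℝ :=
  (2 * Real.pi) ^ (-(d : ℝ) / 2) * S.det ^ (-(1 : ℝ) / 2)
    * Real.exp (-(1 / 2) * ((tangentCoord μ x).ofLp ⬝ᵥ S⁻¹.mulVec (tangentCoord μ x).ofLp))
    * (if x = μ then 1 else (‖tangentCoord μ x‖ / Real.sinh ‖tangentCoord μ x‖) ^ (d - 1))

end

end HWN

/-! The wrapping map at `μ` is a homeomorphism of `ℝ^d` onto hyperbolic space with inverse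
`tangentCoord μ`, so the coordinates of a wrapped normal variable are exactly Gaussian
(`map_tangentCoord_hwn`).

For the density, the differential of the wrapping map keeps radial lengths and stretches orthogonal
directions by `sinh r / r` (`lor_wrapDeriv`). Its Gram determinant is therefore `(sinh r / r) ^ (2
(d - 1))`, and volume in exponential coordinates around any `μ` is `(sinh r / r) ^ (d - 1) dz`
(`hypVolume_eq_map_wrap`). Dividing the Gaussian density by this Jacobian gives `hwnDensity`.

Both the Gaussian factor and `(r / sinh r) ^ (d - 1)` are largest at `r = 0`, the former strictly,
so `μ` is the unique mode. Equal laws have densities that agree almost everywhere, hence everywhere,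
by continuity and the full support of the volume. The mode then determines `μ`, and the law of the
coordinates at `μ` determines the covariance. -/

namespace HWN

open MeasureTheory ProbabilityTheory

noncomputable section

/-! ### Gaussian measures: Lebesgue densities and recovery of the covariance. -/

section Gaussian

variable {ι : Type*} [Fintype ι]

/-- The Lebesgue density of the standard Gaussian measure on a Euclidean space. -/
lemma stdGaussian_eq_withDensity :
    stdGaussian (EuclideanSpace ℝ ι) = volume.withDensity fun x =>
      ENNReal.ofReal ((2 * Real.pi) ^ (-(Fintype.card ι : ℝ) / 2)
        * Real.exp (-(1 / 2) * ‖x‖ ^ 2)) := by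
  have hint : Integrable (fun x : EuclideanSpace ℝ ι =>
      (2 * Real.pi) ^ (-(Fintype.card ι : ℝ) / 2) * Real.exp (-(1 / 2) * ‖x‖ ^ 2)) := by
    have h := (GaussianFourier.integrable_cexp_neg_mul_sq_norm_add_of_euclideanSpace
      (ι := ι) (b := 1 / 2) (by norm_num) 0 0).norm
    refine (h.congr (Filter.Eventually.of_forall fun x => ?_)).const_mul _
    simp [Complex.norm_exp, ← Complex.ofReal_pow]
  have hfin := isFiniteMeasure_withDensity_ofReal hint.2
  apply Measure.ext_of_charFun
  ext t
  rw [charFun_stdGaussian, charFun_apply,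
    integral_withDensity_eq_integral_toReal_smul (by fun_prop)
      (Filter.Eventually.of_forall fun _ => ENNReal.ofReal_lt_top)]
  -- With `b = 1 / 2` and `c = I` this is the Fourier transform of the Gaussian: the constant `(2π)
  -- ^ (n / 2)` times `exp (-‖t‖² / 2)`.
  have h := GaussianFourier.integral_cexp_neg_mul_sq_norm_add_of_euclideanSpace
    (ι := ι) (b := 1 / 2) (by norm_num) Complex.I t
  have hπ : (0 : ℝ) < 2 * Real.pi := by positivity
  have e : ∀ x : EuclideanSpace ℝ ι, (ENNReal.ofReal ((2 * Real.pi) ^ (-(Fintype.card ι : ℝ) / 2)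
        * Real.exp (-(1 / 2) * ‖x‖ ^ 2))).toReal • Complex.exp (inner ℝ x t * Complex.I)
      = (((2 * Real.pi) ^ (-(Fintype.card ι : ℝ) / 2) : ℝ) : ℂ)
        * Complex.exp (-(1 / 2) * (‖x‖ : ℂ) ^ 2 + Complex.I * inner ℝ t x) := by
    intro x
    rw [ENNReal.toReal_ofReal (by positivity), Complex.real_smul, Complex.ofReal_mul, mul_assoc,
      Complex.ofReal_exp, ← Complex.exp_add, real_inner_comm]
    congr 2
    push_cast
    ring
  simp_rw [e]
  rw [integral_const_mul, h, ← mul_assoc]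
  have h2 : (((2 * Real.pi) ^ (-(Fintype.card ι : ℝ) / 2) : ℝ) : ℂ)
      * ((Real.pi : ℂ) / (1 / 2)) ^ ((Fintype.card ι : ℂ) / 2) = 1 := by
    have : ((Real.pi : ℂ) / (1 / 2)) ^ ((Fintype.card ι : ℂ) / 2)
        = (((2 * Real.pi) ^ ((Fintype.card ι : ℝ) / 2) : ℝ) : ℂ) := by
      rw [Complex.ofReal_cpow hπ.le]
      push_cast
      congr 1
      ring
    rw [this, ← Complex.ofReal_mul, ← Real.rpow_add hπ]
    simp [neg_div]
  rw [h2, one_mul, Complex.I_sq]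
  congr 1
  ring

variable [DecidableEq ι]

open scoped MatrixOrder in
/-- The Lebesgue density of a nondegenerate centered Gaussian measure. -/
lemma multivariateGaussian_eq_withDensity {S : Matrix ι ι ℝ} (hS : S.PosDef) :
    multivariateGaussian 0 S = volume.withDensity fun x : EuclideanSpace ℝ ι =>
      ENNReal.ofReal ((2 * Real.pi) ^ (-(Fintype.card ι : ℝ) / 2) * S.det ^ (-(1 : ℝ) / 2)
        * Real.exp (-(1 / 2) * (x.ofLp ⬝ᵥ S⁻¹.mulVec x.ofLp))) := by
  set R := CFC.sqrt S with hR
  have hRR : R * R = S := CFC.sqrt_mul_sqrt_self _ hS.posSemidef.nonneg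
  have hdet : 0 < S.det := hS.det_pos
  have hdR : R.det * R.det = S.det := by rw [← Matrix.det_mul, hRR]
  have hR0 : R.det ≠ 0 := by
    intro h
    rw [h, zero_mul] at hdR
    exact hdet.ne hdR
  have hRu : IsUnit R.det := hR0.isUnit
  have hRsymm : R.transpose = R := by
    have h1 : R.PosSemidef := Matrix.nonneg_iff_posSemidef.mp (CFC.sqrt_nonneg S)
    simpa using h1.isHermitian.eq
  let f : EuclideanSpace ℝ ι →ₗ[ℝ] EuclideanSpace ℝ ι := Matrix.toEuclideanLin R
  have hfdet : LinearMap.det f = R.det := LinearMap.det_toLpLin _ _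
  -- As `S = R * R` with `R` symmetric, `R S⁻¹ R = 1`: the quadratic form pulls back to the squared
  -- norm.
  have hnorm : ∀ y, (f y).ofLp ⬝ᵥ S⁻¹.mulVec (f y).ofLp = ‖y‖ ^ 2 := by
    intro y
    have h1 : (f y).ofLp = R.mulVec y.ofLp := rfl
    rw [h1, ← hRR, Matrix.mul_inv_rev, Matrix.mulVec_mulVec, mul_assoc,
      Matrix.nonsing_inv_mul _ hRu, mul_one, EuclideanSpace.real_norm_sq_eq,
      Matrix.dotProduct_mulVec, ← Matrix.mulVec_transpose, Matrix.mulVec_mulVec,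
      Matrix.transpose_nonsing_inv, hRsymm, Matrix.nonsing_inv_mul _ hRu, Matrix.one_mulVec]
    simp [dotProduct, pow_two]
  have hmeas : Measurable f := f.continuous_of_finiteDimensional.measurable
  have hvol := Measure.map_linearMap_addHaar_eq_smul_addHaar
    (volume : Measure (EuclideanSpace ℝ ι)) (f := f) (by rwa [hfdet])
  have hmap : multivariateGaussian 0 S = (stdGaussian (EuclideanSpace ℝ ι)).map f := by
    simp only [multivariateGaussian, zero_add]
    rfl
  have hq : Measurable fun x : EuclideanSpace ℝ ι =>
      x.ofLp ⬝ᵥ S⁻¹.mulVec x.ofLp := by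
    simp only [dotProduct, Matrix.mulVec]
    fun_prop
  rw [hmap, stdGaussian_eq_withDensity]
  ext A hA
  rw [Measure.map_apply hmeas hA, withDensity_apply _ (hmeas hA), withDensity_apply _ hA]
  -- Linear change of variables, written so that the integral over `A` pulls back to `f ⁻¹' A`,
  -- where the two integrands can be compared pointwise.
  have hvol' : (volume : Measure (EuclideanSpace ℝ ι))
      = ENNReal.ofReal |R.det| • volume.map f := by
    rw [hvol, smul_smul, hfdet, ← ENNReal.ofReal_mul (abs_nonneg _), ← abs_mul,
      mul_inv_cancel₀ hR0]
    simp
  conv_rhs => rw [hvol']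
  rw [Measure.restrict_smul, lintegral_smul_measure, setLIntegral_map hA (by fun_prop) hmeas,
    smul_eq_mul, ← lintegral_const_mul _ (by fun_prop)]
  refine lintegral_congr fun x => ?_
  rw [← ENNReal.ofReal_mul (abs_nonneg _), hnorm]
  congr 1
  have habs : |R.det| * S.det ^ (-(1 : ℝ) / 2) = 1 := by
    have : |R.det| = √S.det := by rw [← hdR, Real.sqrt_mul_self_eq_abs]
    rw [this, Real.sqrt_eq_rpow, ← Real.rpow_add hdet]
    norm_num
  linear_combination (-(2 * Real.pi) ^ (-(Fintype.card ι : ℝ) / 2)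
    * Real.exp (-(1 / 2) * ‖x‖ ^ 2)) * habs

lemma multivariateGaussian_injective {S S' : Matrix ι ι ℝ} (hS : S.PosSemidef)
    (hS' : S'.PosSemidef) (h : multivariateGaussian 0 S = multivariateGaussian 0 S') :
    S = S' := by
  ext i j
  rw [← covariance_eval_multivariateGaussian (μ := 0) hS, h,
    covariance_eval_multivariateGaussian hS']

end Gaussian

/-! ### The function `sinh r / r`. -/

/-- The function `sinh r / r`, extended by `1` at `r = 0`. -/
def sinhc (r : ℝ) : ℝ := dslope Real.sinh 0 r

lemma sinhc_zero : sinhc 0 = 1 := by simp [sinhc]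

lemma sinhc_of_ne {r : ℝ} (h : r ≠ 0) : sinhc r = Real.sinh r / r := by
  simp [sinhc, dslope_of_ne _ h, slope_def_field]

lemma mul_sinhc (r : ℝ) : r * sinhc r = Real.sinh r := by
  rcases eq_or_ne r 0 with rfl | h
  · simp
  · rw [sinhc_of_ne h]
    field_simp

lemma continuous_sinhc : Continuous sinhc := by
  rw [← continuousOn_univ]
  exact (continuousOn_dslope Filter.univ_mem).2
    ⟨Real.continuous_sinh.continuousOn, Real.differentiable_sinh 0⟩

lemma one_le_sinhc {r : ℝ} (h : 0 ≤ r) : 1 ≤ sinhc r := by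
  rcases h.eq_or_lt with rfl | h
  · exact sinhc_zero.ge
  · rw [sinhc_of_ne h.ne', one_le_div h]
    exact Real.self_le_sinh_iff.mpr h.le

variable {d : ℕ}

/-! ### `Exp` and `Log` are mutually inverse. -/

/-- Removes the division by zero at `v = 0`: there the coefficient changes from `0` to `1`, but it
multiplies the zero vector. Continuity can then be read off. -/
lemma expMap_coe (x : Hyp d) (v : Tangent x) :
    (expMap x v).1 = Real.cosh (tnorm v) • x.1 + sinhc (tnorm v) • v.1 := by
  rcases eq_or_ne (tnorm v) 0 with h | h
  · simp [expMap, eq_zero_of_tnorm v h]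
  · rw [sinhc_of_ne h]
    rfl

/-- Equality case of the reversed Cauchy-Schwarz inequality: `y + ⟨x, y⟩ x` is tangent at `x` with
squared norm `⟨x, y⟩² - 1 = 0`, and the form is definite on tangent spaces. -/
lemma eq_of_neg_lor_eq_one {x y : Hyp d} (h : -lor x.1 y.1 = 1) : y = x := by
  have hl : lor x.1 y.1 = -1 := by linarith
  let v : Tangent x := ⟨y.1 + lor x.1 y.1 • x.1, by
    show lor x.1 _ = 0
    rw [lor_add_right, lor_smul_right, x.2.1]
    ring⟩
  have hv : lor v.1 v.1 = 0 := by
    show lor (y.1 + lor x.1 y.1 • x.1) (y.1 + lor x.1 y.1 • x.1) = 0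
    simp only [lor_add_left, lor_add_right, lor_smul_left, lor_smul_right, x.2.1, y.2.1,
      lor_comm y.1 x.1, hl]
    norm_num
  have h0 : y.1 + lor x.1 y.1 • x.1 = 0 := eq_zero_of_tnorm v (by simp [tnorm, hv])
  rw [hl, neg_one_smul] at h0
  exact Subtype.ext (by rwa [← sub_eq_add_neg, sub_eq_zero] at h0)

lemma rho_nonneg (x y : Hyp d) : 0 ≤ rho x y := Real.arcosh_nonneg (one_le_neg_lor x y)

lemma cosh_rho (x y : Hyp d) : Real.cosh (rho x y) = -lor x.1 y.1 :=
  Real.cosh_arcosh (one_le_neg_lor x y)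

/-- The square root in `logMap` is `sinh (rho x y)`, because `-⟨x, y⟩ = cosh (rho x y)`. -/
lemma logMap_coe (x y : Hyp d) :
    (logMap x y).1 = (sinhc (rho x y))⁻¹ • (y.1 + lor x.1 y.1 • x.1) := by
  have hs := Real.sinh_arcosh (one_le_neg_lor x y)
  rcases eq_or_ne (rho x y) 0 with h | h
  · have h1 : -lor x.1 y.1 = 1 := (Real.arcosh_eq_zero_iff (one_le_neg_lor x y)).mp h
    have h2 : lor x.1 y.1 = -1 := by linarith
    have h3 : y.1 + lor x.1 y.1 • x.1 = 0 := by
      rw [h2, eq_of_neg_lor_eq_one h1]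
      simp
    simp [logMap, h3]
  · rw [sinhc_of_ne h, inv_div]
    simp only [logMap, ← hs]
    rfl

lemma tnorm_logMap (x y : Hyp d) : tnorm (logMap x y) = rho x y := by
  have hs : 0 < sinhc (rho x y) := one_pos.trans_le (one_le_sinhc (rho_nonneg x y))
  have h : lor (logMap x y).1 (logMap x y).1 = rho x y ^ 2 := by
    have hc := Real.cosh_sq (rho x y)
    rw [cosh_rho, ← mul_sinhc] at hc
    rw [logMap_coe]
    simp only [lor_add_left, lor_add_right, lor_smul_left, lor_smul_right, x.2.1, y.2.1,
      lor_comm y.1 x.1]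
    field_simp
    linear_combination hc
  rw [tnorm, h, Real.sqrt_sq (rho_nonneg x y)]

lemma expMap_logMap (x y : Hyp d) : expMap x (logMap x y) = y := by
  have hs : sinhc (rho x y) ≠ 0 := (one_pos.trans_le (one_le_sinhc (rho_nonneg x y))).ne'
  apply Subtype.ext
  rw [expMap_coe, tnorm_logMap, logMap_coe, smul_smul, mul_inv_cancel₀ hs, cosh_rho]
  simp

lemma logMap_expMap (x : Hyp d) (v : Tangent x) : logMap x (expMap x v) = v := by
  have h0 : 0 ≤ tnorm v := Real.sqrt_nonneg _
  have hs : sinhc (tnorm v) ≠ 0 := (one_pos.trans_le (one_le_sinhc h0)).ne'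
  have hl : lor x.1 (expMap x v).1 = -Real.cosh (tnorm v) := by
    rw [expMap_coe, lor_add_right, lor_smul_right, lor_smul_right, lor_tangent, x.2.1]
    ring
  have hr : rho x (expMap x v) = tnorm v := by
    rw [rho, hl, neg_neg, Real.arcosh_cosh h0]
  apply Subtype.ext
  rw [logMap_coe, hr, hl, expMap_coe]
  simp [smul_smul, inv_mul_cancel₀ hs]

/-! ### Isometric frames; the wrapping map and its continuous inverse. -/

lemma lor_transport (x y : Hyp d) (v w : Tangent x) :
    lor (transport x y v).1 (transport x y w).1 = lor v.1 w.1 := by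
  have h := one_le_neg_lor x y
  have hne : 1 - lor x.1 y.1 ≠ 0 := by linarith
  show lor (v.1 + (lor y.1 v.1 / (1 - lor x.1 y.1)) • (x.1 + y.1))
    (w.1 + (lor y.1 w.1 / (1 - lor x.1 y.1)) • (x.1 + y.1)) = _
  simp only [lor_add_left, lor_add_right, lor_smul_left, lor_smul_right, x.2.1, y.2.1,
    lor_comm y.1 x.1, lor_comm v.1 x.1, lor_comm v.1 y.1, lor_tangent]
  field_simp
  ring

lemma lor_originIso (a b : EuclideanSpace ℝ (Fin d)) :
    lor (originIso d a).1 (originIso d b).1 = inner ℝ a b := by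
  simp [lor, originIso, PiLp.inner_apply, mul_comm]

/-- The linear isometry `PT_{o → μ}` of `ℝ^d` onto the tangent space at `μ`, as a map into the
ambient space. -/
def frame (μ : Hyp d) : EuclideanSpace ℝ (Fin d) →L[ℝ] (Fin (d + 1) → ℝ) :=
  LinearMap.toContinuousLinearMap ((Tangent μ).subtype ∘ₗ
    (transport (origin d) μ).toLinearMap ∘ₗ (originIso d).toLinearMap)

lemma frame_apply (μ : Hyp d) (z : EuclideanSpace ℝ (Fin d)) :
    frame μ z = (transport (origin d) μ (originIso d z)).1 := rfl

lemma lor_frame (μ : Hyp d) (a b : EuclideanSpace ℝ (Fin d)) :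
    lor (frame μ a) (frame μ b) = inner ℝ a b := by
  rw [frame_apply, frame_apply, lor_transport, lor_originIso]

lemma lor_frame_right (μ : Hyp d) (a : EuclideanSpace ℝ (Fin d)) :
    lor μ.1 (frame μ a) = 0 := lor_tangent _

lemma tnorm_transport_originIso (μ : Hyp d) (z : EuclideanSpace ℝ (Fin d)) :
    tnorm (transport (origin d) μ (originIso d z)) = ‖z‖ := by
  rw [tnorm, ← frame_apply, lor_frame, real_inner_self_eq_norm_sq, Real.sqrt_sq (norm_nonneg _)]

lemma wrap_coe (μ : Hyp d) (z : EuclideanSpace ℝ (Fin d)) :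
    (wrap μ z).1 = Real.cosh ‖z‖ • μ.1 + sinhc ‖z‖ • frame μ z := by
  rw [wrap, expMap_coe, tnorm_transport_originIso, frame_apply]

lemma continuous_wrap (μ : Hyp d) : Continuous (wrap μ) := by
  refine continuous_induced_rng.2 ?_
  have : (Subtype.val ∘ wrap μ) = fun z => Real.cosh ‖z‖ • μ.1 + sinhc ‖z‖ • frame μ z :=
    funext (wrap_coe μ)
  rw [this]
  exact ((Real.continuous_cosh.comp continuous_norm).smul continuous_const).add
    ((continuous_sinhc.comp continuous_norm).smul (frame μ).continuous)

lemma tangentCoord_wrap (μ : Hyp d) (z : EuclideanSpace ℝ (Fin d)) :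
    tangentCoord μ (wrap μ z) = z := by
  simp [tangentCoord, wrap, logMap_expMap]

lemma wrap_tangentCoord (μ x : Hyp d) : wrap μ (tangentCoord μ x) = x := by
  simp [tangentCoord, wrap, expMap_logMap]

lemma wrap_injective (μ : Hyp d) : Function.Injective (wrap μ) :=
  Function.LeftInverse.injective (tangentCoord_wrap μ)

lemma wrap_zero (μ : Hyp d) : wrap μ 0 = μ := Subtype.ext (by simp [wrap_coe])

lemma tangentCoord_self (μ : Hyp d) : tangentCoord μ μ = 0 := by
  simpa [wrap_zero] using tangentCoord_wrap μ 0

lemma tangentCoord_eq_zero_iff {μ x : Hyp d} : tangentCoord μ x = 0 ↔ x = μ := by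
  refine ⟨fun h => ?_, fun h => h ▸ tangentCoord_self μ⟩
  rw [← wrap_tangentCoord μ x, h, wrap_zero]

lemma continuous_lor (x : Fin (d + 1) → ℝ) : Continuous fun y => lor x y := by
  unfold lor
  fun_prop

lemma continuous_logMap (x : Hyp d) : Continuous (logMap x) := by
  refine continuous_induced_rng.2 ?_
  have : (Subtype.val ∘ logMap x)
      = fun y => (sinhc (rho x y))⁻¹ • (y.1 + lor x.1 y.1 • x.1) := funext (logMap_coe x)
  rw [this]
  have hl : Continuous fun y : Hyp d => lor x.1 y.1 :=
    (continuous_lor x.1).comp continuous_subtype_val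
  have hr : Continuous fun y : Hyp d => rho x y :=
    Real.continuousOn_arcosh.comp_continuous hl.neg fun y => one_le_neg_lor x y
  refine Continuous.smul (Continuous.inv₀ (continuous_sinhc.comp hr) fun y => ?_)
    (continuous_subtype_val.add (hl.smul continuous_const))
  exact (one_pos.trans_le (one_le_sinhc (rho_nonneg x y))).ne'

lemma continuous_tangentCoord (μ : Hyp d) : Continuous (tangentCoord μ) :=
  ((originIso d).symm.toLinearMap ∘ₗ
    (transport (origin d) μ).symm.toLinearMap).continuous_of_finiteDimensional.comp
      (continuous_logMap μ)

/-! ### Volume in exponential coordinates. -/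

/-- The Lorentz form as a bilinear form. -/
def lorForm (d : ℕ) : LinearMap.BilinForm ℝ (Fin (d + 1) → ℝ) :=
  LinearMap.mk₂ ℝ lor lor_add_left lor_smul_left lor_add_right lor_smul_right

lemma lorForm_apply (x y : Fin (d + 1) → ℝ) : lorForm d x y = lor x y := rfl

/-- The projection of the ambient space to the last `d` coordinates. -/
def tailMap (d : ℕ) : (Fin (d + 1) → ℝ) →L[ℝ] EuclideanSpace ℝ (Fin d) :=
  LinearMap.toContinuousLinearMap
    { toFun := fun x => WithLp.toLp 2 (Fin.tail x)
      map_add' := fun _ _ => rfl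
      map_smul' := fun _ _ => rfl }

lemma tailMap_apply (x : Fin (d + 1) → ℝ) : tailMap d x = WithLp.toLp 2 (Fin.tail x) := rfl

lemma tailMap_graphMap (u : EuclideanSpace ℝ (Fin d)) : tailMap d (graphMap u).1 = u := by
  ext i
  simp [tailMap_apply, graphMap, graphVec]

lemma graphMap_tailMap (x : Hyp d) : graphMap (tailMap d x.1) = x := by
  have h : 1 + ‖tailMap d x.1‖ ^ 2 = x.1 0 ^ 2 := by
    have h1 := x.2.1
    rw [EuclideanSpace.real_norm_sq_eq]
    simp only [lor, ← pow_two] at h1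
    simp only [tailMap_apply, Fin.tail]
    linarith
  apply Subtype.ext
  show Fin.cons √(1 + ‖tailMap d x.1‖ ^ 2) (Fin.tail x.1) = x.1
  rw [h, Real.sqrt_sq x.2.2.le, Fin.cons_self_tail]

lemma differentiable_graphVec : Differentiable ℝ (graphVec (d := d)) := by
  rw [differentiable_pi]
  intro i
  refine Fin.cases ?_ (fun j => ?_) i
  · simp only [graphVec, Fin.cons_zero]
    refine Differentiable.sqrt ((differentiable_const _).add ?_) fun u => by positivity
    exact (differentiable_id.norm_sq ℝ)
  · simp only [graphVec, Fin.cons_succ]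
    fun_prop

lemma measurable_graphMap : Measurable (graphMap (d := d)) :=
  differentiable_graphVec.continuous.measurable.subtype_mk

/-- The derivative of the wrapping map away from the origin. -/
def wrapDeriv (μ : Hyp d) (z : EuclideanSpace ℝ (Fin d)) :
    EuclideanSpace ℝ (Fin d) →L[ℝ] (Fin (d + 1) → ℝ) :=
  (innerSL ℝ z).smulRight (sinhc ‖z‖ • μ.1
    + ((‖z‖ * Real.cosh ‖z‖ - Real.sinh ‖z‖) / ‖z‖ ^ 3) • frame μ z) + sinhc ‖z‖ • frame μ

/-- The point `z = 0` is left out because the norm is not differentiable there; being a null set, it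
does not affect the change of variables. -/
lemma hasFDerivAt_wrap (μ : Hyp d) {z : EuclideanSpace ℝ (Fin d)} (hz : z ≠ 0) :
    HasFDerivAt (fun y => (wrap μ y).1) (wrapDeriv μ z) z := by
  have hr : ‖z‖ ≠ 0 := norm_ne_zero_iff.mpr hz
  have hn : HasFDerivAt (fun y : EuclideanSpace ℝ (Fin d) => ‖y‖) (‖z‖⁻¹ • innerSL ℝ z) z := by
    have h1 := (hasStrictFDerivAt_norm_sq z).hasFDerivAt.sqrt (pow_ne_zero 2 hr)
    simp only [Real.sqrt_sq (norm_nonneg _)] at h1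
    refine h1.congr_fderiv ?_
    ext a
    simp
    field_simp
  have hs : HasDerivAt sinhc ((Real.cosh ‖z‖ * ‖z‖ - Real.sinh ‖z‖ * 1) / ‖z‖ ^ 2) ‖z‖ := by
    refine ((Real.hasDerivAt_sinh ‖z‖).div (hasDerivAt_id _) hr).congr_of_eventuallyEq ?_
    filter_upwards [isOpen_ne.mem_nhds hr] with r hr'
    exact sinhc_of_ne hr'
  have h := (((Real.hasDerivAt_cosh ‖z‖).comp_hasFDerivAt z hn).smul_const μ.1).add
    ((hs.comp_hasFDerivAt z hn).smul (frame μ).hasFDerivAt)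
  rw [funext (wrap_coe μ)]
  refine h.congr_fderiv ?_
  ext a i
  simp [wrapDeriv, sinhc_of_ne hr]
  field_simp
  ring

/-- The Gauss lemma in coordinates: the pulled-back metric is Euclidean along `z` and is scaled by
`sinhc ‖z‖ ^ 2` on the orthogonal complement of `z`. -/
lemma lor_wrapDeriv (μ : Hyp d) {z : EuclideanSpace ℝ (Fin d)} (hz : z ≠ 0)
    (a b : EuclideanSpace ℝ (Fin d)) :
    lor (wrapDeriv μ z a) (wrapDeriv μ z b) = sinhc ‖z‖ ^ 2 * inner ℝ a b
      + (1 - sinhc ‖z‖ ^ 2) / ‖z‖ ^ 2 * (inner ℝ z a * inner ℝ z b) := by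
  have hr : ‖z‖ ≠ 0 := norm_ne_zero_iff.mpr hz
  have hc := Real.cosh_sq ‖z‖
  simp only [wrapDeriv, add_apply, ContinuousLinearMap.smulRight_apply,
    smul_apply, lor_add_left, lor_add_right, lor_smul_left, lor_smul_right,
    lor_comm (frame μ _) μ.1, lor_frame, lor_frame_right, μ.2.1, innerSL_apply_apply,
    real_inner_self_eq_norm_sq, real_inner_comm z a]
  rw [sinhc_of_ne hr]
  generalize inner ℝ z a = p
  generalize inner ℝ z b = q
  field_simp
  linear_combination (p * q) * ‖z‖ ^ 2 * hc

/-- The Gram matrix is a scalar matrix plus a rank-one matrix, so the matrix determinant lemma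
applies. -/
lemma det_gram_wrapDeriv (hd : 1 ≤ d) (μ : Hyp d) {z : EuclideanSpace ℝ (Fin d)} (hz : z ≠ 0) :
    (LinearMap.BilinForm.toMatrix (EuclideanSpace.basisFun (Fin d) ℝ).toBasis
      ((lorForm d).comp (wrapDeriv μ z).toLinearMap (wrapDeriv μ z).toLinearMap)).det
      = (sinhc ‖z‖ ^ (d - 1)) ^ 2 := by
  have hr : ‖z‖ ≠ 0 := norm_ne_zero_iff.mpr hz
  have hs : sinhc ‖z‖ ≠ 0 := (one_pos.trans_le (one_le_sinhc (norm_nonneg z))).ne'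
  -- Chosen so that the Gram matrix is `sinhc ‖z‖ ^ 2 • (1 + k z zᵀ)`.
  set k := (1 - sinhc ‖z‖ ^ 2) / ‖z‖ ^ 2 / sinhc ‖z‖ ^ 2 with hk
  have hM : LinearMap.BilinForm.toMatrix (EuclideanSpace.basisFun (Fin d) ℝ).toBasis
      ((lorForm d).comp (wrapDeriv μ z).toLinearMap (wrapDeriv μ z).toLinearMap)
      = sinhc ‖z‖ ^ 2 • (1 + Matrix.replicateCol Unit (k • z.ofLp)
        * Matrix.replicateRow Unit z.ofLp) := by
    ext i j
    simp only [LinearMap.BilinForm.toMatrix_apply, LinearMap.BilinForm.comp_apply, lorForm_apply,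
      ContinuousLinearMap.coe_coe, lor_wrapDeriv μ hz]
    simp only [OrthonormalBasis.coe_toBasis, EuclideanSpace.basisFun_apply,
      EuclideanSpace.inner_single_right, hk, Matrix.smul_apply, Matrix.add_apply,
      Matrix.one_apply, Matrix.mul_apply]
    simp [eq_comm]
    split_ifs
    · field_simp
    · field_simp
      ring
  rw [hM, Matrix.det_smul, Matrix.det_one_add_replicateCol_mul_replicateRow]
  have hz2 : z.ofLp ⬝ᵥ (k • z.ofLp) = k * ‖z‖ ^ 2 := by
    rw [dotProduct_smul, EuclideanSpace.real_norm_sq_eq]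
    simp [dotProduct, pow_two]
  -- The radial eigenvalue is `1`; it absorbs one of the `d` factors `sinhc ‖z‖ ^ 2`, which leaves
  -- `d - 1`.
  have h1 : sinhc ‖z‖ ^ 2 * (1 + k * ‖z‖ ^ 2) = 1 := by
    rw [hk]
    field_simp
    ring
  obtain ⟨n, rfl⟩ : ∃ n, d = n + 1 := ⟨d - 1, by omega⟩
  rw [hz2, Fintype.card_fin, pow_succ, mul_assoc, h1, mul_one, Nat.add_sub_cancel, ← pow_mul,
    ← pow_mul, mul_comm]

/-- The wrapping map is the graph parametrization after `F = tailMap ∘ wrap`. By the chain rule its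
Gram matrix is `Fᵀ g F`, with `g` the metric matrix; take determinants and square roots. -/
lemma abs_det_mul_sqrt_det_metricMatrix (hd : 1 ≤ d) (μ : Hyp d)
    {z : EuclideanSpace ℝ (Fin d)} (hz : z ≠ 0) :
    |((tailMap d).comp (wrapDeriv μ z)).det| * √(metricMatrix (tailMap d (wrap μ z).1)).det
      = sinhc ‖z‖ ^ (d - 1) := by
  set F := (tailMap d).comp (wrapDeriv μ z)
  set u := tailMap d (wrap μ z).1
  set D := fderiv ℝ (graphVec (d := d)) u
  have hs : 0 ≤ sinhc ‖z‖ := zero_le_one.trans (one_le_sinhc (norm_nonneg z))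
  have hF : HasFDerivAt (fun y => tailMap d (wrap μ y).1) F z :=
    (tailMap d).hasFDerivAt.comp z (hasFDerivAt_wrap μ hz)
  -- Uniqueness of the derivative, since `graphMap ∘ F = wrap μ`.
  have hDF : D.comp F = wrapDeriv μ z := by
    have h := (differentiable_graphVec u).hasFDerivAt.comp z hF
    refine h.unique ((hasFDerivAt_wrap μ hz).congr_of_eventuallyEq
      (Filter.Eventually.of_forall fun y => ?_))
    exact congrArg Subtype.val (graphMap_tailMap (wrap μ y))
  have hdet := det_gram_wrapDeriv hd μ hz
  set b := (EuclideanSpace.basisFun (Fin d) ℝ).toBasis with hb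
  have hg : LinearMap.BilinForm.toMatrix b
      ((lorForm d).comp D.toLinearMap D.toLinearMap) = metricMatrix u := by
    ext i j
    simp [LinearMap.BilinForm.toMatrix_apply, lorForm_apply, metricMatrix, hb, D]
  have hcomp : (lorForm d).comp (wrapDeriv μ z).toLinearMap (wrapDeriv μ z).toLinearMap
      = ((lorForm d).comp D.toLinearMap D.toLinearMap).comp F.toLinearMap F.toLinearMap := by
    rw [← hDF]
    rfl
  rw [hcomp, LinearMap.BilinForm.toMatrix_comp b b, hg, Matrix.det_mul, Matrix.det_mul,
    Matrix.det_transpose, LinearMap.det_toMatrix] at hdet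
  have hdet' : F.det ^ 2 * (metricMatrix u).det = (sinhc ‖z‖ ^ (d - 1)) ^ 2 := by
    rw [← hdet, ContinuousLinearMap.det]
    ring
  rw [← Real.sqrt_sq_eq_abs, ← Real.sqrt_mul (sq_nonneg _), hdet', Real.sqrt_sq (by positivity)]

/-- The hyperbolic volume in exponential coordinates around any point. -/
lemma hypVolume_eq_map_wrap (hd : 1 ≤ d) (μ : Hyp d) :
    hypVolume d = ((volume : Measure (EuclideanSpace ℝ (Fin d))).withDensity
      fun z => ENNReal.ofReal (sinhc ‖z‖ ^ (d - 1))).map (wrap μ) := by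
  -- Points are Lebesgue null only in positive dimension.
  have : Nonempty (Fin d) := ⟨⟨0, hd⟩⟩
  ext A hA
  have hwA := measurable_wrap μ hA
  have hgA := measurable_graphMap hA
  rw [hypVolume, Measure.map_apply measurable_graphMap hA,
    Measure.map_apply (measurable_wrap μ) hA, withDensity_apply _ hgA, withDensity_apply _ hwA]
  set F : EuclideanSpace ℝ (Fin d) → EuclideanSpace ℝ (Fin d) :=
    fun z => tailMap d (wrap μ z).1 with hFdef
  have hF : ∀ z, z ≠ 0 → HasFDerivAt F ((tailMap d).comp (wrapDeriv μ z)) z := fun z hz =>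
    (tailMap d).hasFDerivAt.comp z (hasFDerivAt_wrap μ hz)
  have hgF : ∀ z, graphMap (F z) = wrap μ z := fun z => graphMap_tailMap _
  have hFinj : Function.Injective F := fun y z h =>
    wrap_injective μ (by rw [← hgF, ← hgF, h])
  -- `F` is a bijection of `ℝ^d`; the origin and its image are removed so that `F` is differentiable
  -- at every remaining point.
  have himage : F '' (wrap μ ⁻¹' A \ {0}) = graphMap ⁻¹' A \ {F 0} := by
    rw [Set.image_sdiff hFinj, Set.image_singleton]
    congr 1
    ext u
    constructor
    · rintro ⟨z, hz, rfl⟩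
      rw [Set.mem_preimage, hgF]
      exact hz
    · intro hu
      refine ⟨tangentCoord μ (graphMap u), ?_, ?_⟩
      · rw [Set.mem_preimage, wrap_tangentCoord]
        exact hu
      · rw [hFdef]
        simp only [wrap_tangentCoord, tailMap_graphMap]
  rw [← setLIntegral_congr (sdiff_null_ae_eq_self (measure_singleton (F 0))), ← himage,
    lintegral_image_eq_lintegral_abs_det_fderiv_mul volume
      (hwA.diff (measurableSet_singleton 0))
      (fun z hz => (hF z hz.2).hasFDerivWithinAt)
      hFinj.injOn,
    ← setLIntegral_congr (s := wrap μ ⁻¹' A \ {0}) (t := wrap μ ⁻¹' A)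
      (sdiff_null_ae_eq_self (measure_singleton 0))]
  refine setLIntegral_congr_fun (hwA.diff (measurableSet_singleton 0)) fun z hz => ?_
  rw [← abs_det_mul_sqrt_det_metricMatrix hd μ hz.2, ENNReal.ofReal_mul (abs_nonneg _)]

/-- In exponential coordinates the volume has a strictly positive Lebesgue density. This is what
later turns almost everywhere equality of continuous densities into equality. -/
lemma isOpenPosMeasure_hypVolume (hd : 1 ≤ d) : (hypVolume d).IsOpenPosMeasure where
  open_pos U hU hne h0 := by
    have hV : IsOpen (wrap (origin d) ⁻¹' U) := hU.preimage (continuous_wrap _)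
    obtain ⟨x, hx⟩ := hne
    have hVne : (wrap (origin d) ⁻¹' U).Nonempty :=
      ⟨tangentCoord (origin d) x, by rwa [Set.mem_preimage, wrap_tangentCoord]⟩
    rw [hypVolume_eq_map_wrap hd (origin d), Measure.map_apply (measurable_wrap _) hU.measurableSet,
      withDensity_apply_eq_zero' (by have := continuous_sinhc; fun_prop)] at h0
    refine (hV.measure_pos volume hVne).ne' (measure_mono_null ?_ h0)
    refine fun z hz => ⟨?_, hz⟩
    have := one_pos.trans_le (one_le_sinhc (norm_nonneg z))
    simp only [Set.mem_ofPred_eq, ne_eq, ENNReal.ofReal_eq_zero, not_le]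
    positivity

/-! ### The density: continuity, unique mode, agreement with the law. -/

lemma hwnDensity_eq (μ : Hyp d) (S : Matrix (Fin d) (Fin d) ℝ) (x : Hyp d) :
    hwnDensity μ S x = (2 * Real.pi) ^ (-(d : ℝ) / 2) * S.det ^ (-(1 : ℝ) / 2)
      * Real.exp (-(1 / 2) * ((tangentCoord μ x).ofLp ⬝ᵥ S⁻¹.mulVec (tangentCoord μ x).ofLp))
      * (sinhc ‖tangentCoord μ x‖ ^ (d - 1))⁻¹ := by
  rw [hwnDensity]
  congr 1
  split_ifs with h
  · simp [h, tangentCoord_self, sinhc_zero]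
  · have hT : ‖tangentCoord μ x‖ ≠ 0 := by
      rwa [norm_ne_zero_iff, Ne, tangentCoord_eq_zero_iff]
    rw [sinhc_of_ne hT, ← inv_pow, inv_div]

lemma continuous_hwnDensity (μ : Hyp d) (S : Matrix (Fin d) (Fin d) ℝ) :
    Continuous (hwnDensity μ S) := by
  have hT := continuous_tangentCoord μ
  rw [funext (hwnDensity_eq μ S)]
  refine Continuous.mul ?_ (((continuous_sinhc.comp hT.norm).pow _).inv₀ fun x => ?_)
  · simp only [dotProduct, Matrix.mulVec]
    fun_prop
  · exact pow_ne_zero _ (one_pos.trans_le (one_le_sinhc (norm_nonneg _))).ne'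

lemma hwnDensity_nonneg (μ : Hyp d) {S : Matrix (Fin d) (Fin d) ℝ} (hS : S.PosDef) (x : Hyp d) :
    0 ≤ hwnDensity μ S x := by
  have := one_pos.trans_le (one_le_sinhc (norm_nonneg (tangentCoord μ x)))
  have := hS.det_pos
  rw [hwnDensity_eq]
  positivity

lemma hwnDensity_lt (μ : Hyp d) {S : Matrix (Fin d) (Fin d) ℝ} (hS : S.PosDef) {x : Hyp d}
    (hx : x ≠ μ) : hwnDensity μ S x < hwnDensity μ S μ := by
  have hdet := hS.det_pos
  have hT : (tangentCoord μ x).ofLp ≠ 0 := by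
    rwa [Ne, WithLp.ofLp_eq_zero, tangentCoord_eq_zero_iff]
  have hq := hS.inv.dotProduct_mulVec_pos hT
  rw [star_trivial] at hq
  have hs : (sinhc ‖tangentCoord μ x‖ ^ (d - 1))⁻¹ ≤ 1 :=
    inv_le_one_of_one_le₀ (one_le_pow₀ (one_le_sinhc (norm_nonneg _)))
  have he : Real.exp (-(1 / 2) *
      ((tangentCoord μ x).ofLp ⬝ᵥ S⁻¹.mulVec (tangentCoord μ x).ofLp)) < 1 := by
    rw [Real.exp_lt_one_iff]
    linarith
  rw [hwnDensity_eq, hwnDensity_eq μ S μ, tangentCoord_self]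
  simp only [WithLp.ofLp_zero, zero_dotProduct, mul_zero, Real.exp_zero, norm_zero, sinhc_zero,
    one_pow, inv_one, mul_one]
  calc _ ≤ (2 * Real.pi) ^ (-(d : ℝ) / 2) * S.det ^ (-(1 : ℝ) / 2)
      * Real.exp (-(1 / 2) * ((tangentCoord μ x).ofLp ⬝ᵥ S⁻¹.mulVec (tangentCoord μ x).ofLp)) :=
        mul_le_of_le_one_right (by positivity) hs
    _ < _ := mul_lt_of_lt_one_right (by positivity) he

/-- Both sides are pulled back along `wrap μ`; the volume Jacobian `sinhc ‖z‖ ^ (d - 1)` cancels the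
last factor of the density and leaves the Gaussian density. -/
lemma hwn_eq_withDensity (hd : 1 ≤ d) (μ : Hyp d) {S : Matrix (Fin d) (Fin d) ℝ}
    (hS : S.PosDef) :
    hwn μ S = (hypVolume d).withDensity fun x => ENNReal.ofReal (hwnDensity μ S x) := by
  have hp : Measurable fun x => ENNReal.ofReal (hwnDensity μ S x) :=
    (continuous_hwnDensity μ S).measurable.ennreal_ofReal
  have hs : Measurable fun z : EuclideanSpace ℝ (Fin d) =>
      ENNReal.ofReal (sinhc ‖z‖ ^ (d - 1)) := by
    have := continuous_sinhc
    fun_prop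
  have hw := measurable_wrap μ
  ext A hA
  rw [hwn, multivariateGaussian_eq_withDensity hS, hypVolume_eq_map_wrap hd μ,
    Measure.map_apply hw hA, withDensity_apply _ (hw hA), withDensity_apply _ hA,
    setLIntegral_map hA hp hw]
  refine Eq.trans ?_
    (setLIntegral_withDensity_eq_setLIntegral_mul _ hs (hp.comp hw) (hw hA)).symm
  refine lintegral_congr fun z => ?_
  have h1 := one_pos.trans_le (one_le_sinhc (norm_nonneg z))
  rw [Pi.mul_apply, Function.comp_apply, ← ENNReal.ofReal_mul (by positivity), hwnDensity_eq,
    tangentCoord_wrap, Fintype.card_fin]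
  congr 1
  field_simp

/-! ### Law of the tangent coordinates and identifiability. -/

lemma map_tangentCoord_hwn (μ : Hyp d) (S : Matrix (Fin d) (Fin d) ℝ) :
    (hwn μ S).map (tangentCoord μ) = multivariateGaussian 0 S := by
  rw [hwn, Measure.map_map (continuous_tangentCoord μ).measurable (measurable_wrap μ)]
  have : tangentCoord μ ∘ wrap μ = id := funext (tangentCoord_wrap μ)
  rw [this, Measure.map_id]

instance isProbabilityMeasure_hwn (μ : Hyp d) (S : Matrix (Fin d) (Fin d) ℝ) :
    IsProbabilityMeasure (hwn μ S) :=
  Measure.isProbabilityMeasure_map (measurable_wrap μ).aemeasurable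

lemma hwnDensity_eq_of_hwn_eq (hd : 1 ≤ d) {μ μ' : Hyp d} {S S' : Matrix (Fin d) (Fin d) ℝ}
    (hS : S.PosDef) (hS' : S'.PosDef) (h : hwn μ S = hwn μ' S') :
    hwnDensity μ S = hwnDensity μ' S' := by
  have hpos := isOpenPosMeasure_hypVolume hd
  have hc := continuous_hwnDensity μ S
  have hc' := continuous_hwnDensity μ' S'
  -- Finite total mass allows densities of equal measures to be compared almost everywhere.
  have hfin : ∫⁻ x, ENNReal.ofReal (hwnDensity μ S x) ∂(hypVolume d) ≠ ⊤ := by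
    rw [← setLIntegral_univ, ← withDensity_apply _ MeasurableSet.univ,
      ← hwn_eq_withDensity hd μ hS]
    exact measure_ne_top _ _
  rw [hwn_eq_withDensity hd μ hS, hwn_eq_withDensity hd μ' hS', withDensity_eq_iff
    hc.measurable.ennreal_ofReal.aemeasurable hc'.measurable.ennreal_ofReal.aemeasurable hfin] at h
  replace h := Measure.eq_of_ae_eq h (ENNReal.continuous_ofReal.comp hc)
    (ENNReal.continuous_ofReal.comp hc')
  funext x
  exact (ENNReal.ofReal_eq_ofReal_iff (hwnDensity_nonneg μ hS x)
    (hwnDensity_nonneg μ' hS' x)).mp (congrFun h x)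

lemma hwn_identifiable (hd : 1 ≤ d) {μ μ' : Hyp d} {S S' : Matrix (Fin d) (Fin d) ℝ}
    (hS : S.PosDef) (hS' : S'.PosDef) (h : hwn μ S = hwn μ' S') : μ = μ' ∧ S = S' := by
  have hμ : μ = μ' := by
    -- Otherwise the common density would be strictly larger at each of `μ`, `μ'` than at the other.
    by_contra hne
    have hp := hwnDensity_eq_of_hwn_eq hd hS hS' h
    have h1 := hwnDensity_lt μ hS (Ne.symm hne)
    have h2 := hwnDensity_lt μ' hS' hne
    rw [hp] at h1
    exact h1.asymm h2
  subst hμ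
  refine ⟨rfl, multivariateGaussian_injective hS.posSemidef hS'.posSemidef ?_⟩
  rw [← map_tangentCoord_hwn μ S, h, map_tangentCoord_hwn]

end

end HWN

theorem mainTheorem7 (d : ℕ) (hd : 2 ≤ d) :
    (∀ (μ μ' : HWN.Hyp d) (S S' : Matrix (Fin d) (Fin d) ℝ), S.PosDef → S'.PosDef →
      HWN.hwn μ S = HWN.hwn μ' S' → μ = μ' ∧ S = S') ∧
    (∀ (μ : HWN.Hyp d) (S : Matrix (Fin d) (Fin d) ℝ), S.PosDef →
      HWN.hwn μ S = (HWN.hypVolume d).withDensity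
        (fun x => ENNReal.ofReal (HWN.hwnDensity μ S x)) ∧
      Continuous (HWN.hwnDensity μ S) ∧
      (∀ x : HWN.Hyp d, x ≠ μ → HWN.hwnDensity μ S x < HWN.hwnDensity μ S μ) ∧
      (HWN.hwn μ S).map (HWN.tangentCoord μ) =
        ProbabilityTheory.multivariateGaussian 0 S) := by
  have hd1 : 1 ≤ d := one_le_two.trans hd
  exact ⟨fun μ μ' S S' hS hS' h => HWN.hwn_identifiable hd1 hS hS' h,
    fun μ S hS => ⟨HWN.hwn_eq_withDensity hd1 μ hS, HWN.continuous_hwnDensity μ S,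
      fun x hx => HWN.hwnDensity_lt μ hS hx, HWN.map_tangentCoord_hwn μ S⟩⟩
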